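/- Let $V=\bigoplus_{n\in\mathbb Z}V_n$ be a vertex operator algebra over $\mathbb C$ of CFT type, that is, $V_n=0$ for $n<0$ and $V_0=\mathbb C\mathbf 1$. Let $C_2(V)$ be the linear span of all vectors $v_{-2}w$ with $v,w\in V$, where $Y(v,z)=\sum_{n\in\mathbb Z}v_nz^{-n-1}$, and suppose that $V$ is $C_2$-cofinite, that is, $\dim V/C_2(V)<\infty$. A weak $V$-module is a complex vector space $M$ with a linear map $Y_M:V\to \mathrm{End}(M)[[z,z^{-1}]]$, $v\mapsto Y_M(v,z)=\sum_{n\in\mathbb Z}v_nz^{-n-1}$, such that $v_nw=0$ for all sufficiently large $n$ (for each $v\in V$, $w\in M$), $Y_M(\mathbf 1,z)=\mathrm{id}_M$, and the Jacobi identity $$z_0^{-1}\delta\Big(\frac{z_1-z_2}{z_0}\Big)Y_M(u,z_1)Y_M(v,z_2)-z_0^{-1}\delta\Big(\frac{z_2-z_1}{-z_0}\Big)Y_M(v,z_2)Y_M(u,z_1)=z_2^{-1}\delta\Big(\frac{z_1-z_0}{z_2}\Big)Y_M(Y(u,z_0)v,z_2)$$ holds for all $u,v\in V$. Then every weak $V$-module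 $M$ is admissible: there is a grading $M=\bigoplus_{n\ge 0}M(n)$ by the nonnegative integers such that $v_mM(n)\subseteq M(n+r-m-1)$ for all $r,m\in\mathbb Z$, $n\ge 0$ and $v\in V_r$, where $M(k)=0$ for $k<0$. -/

import Mathlib

noncomputable section

/-- For complex vector spaces `V` and `M`, a linear map `V → End(M)[[z, z⁻¹]]`. The operator
`Y v n` is the mode `v_n`, that is, `Y(v, z) = ∑_{n ∈ ℤ} (Y v n) z^{-n-1}`. -/
abbrev ModeMap (V M : Type*) [AddCommGroup V] [Module ℂ V] [AddCommGroup M] [Module ℂ M] :=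
  V →ₗ[ℂ] (ℤ → Module.End ℂ M)

namespace ModeMap

variable {V M : Type*} [AddCommGroup V] [Module ℂ V] [AddCommGroup M] [Module ℂ M]

/-- The truncation condition: `v_n w = 0` for `n` sufficiently large, for all `v` and `w`. -/
def Truncated (YM : ModeMap V M) : Prop :=
  ∀ (v : V) (w : M), ∃ N : ℤ, ∀ n : ℤ, N ≤ n → YM v n w = 0

/-- The Jacobi identity
`z₀⁻¹ δ((z₁ - z₂)/z₀) Y_M(u,z₁) Y_M(v,z₂) - z₀⁻¹ δ((z₂ - z₁)/(-z₀)) Y_M(v,z₂) Y_M(u,z₁)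
  = z₂⁻¹ δ((z₁ - z₀)/z₂) Y_M(Y(u,z₀)v, z₂)`,
applied to a vector `w`, coefficient by coefficient: the equation below compares the coefficients
of `z₀^{-l-1} z₁^{-m-1} z₂^{-n-1}`, where `δ(z) = ∑_{k ∈ ℤ} z^k` and every binomial is expanded in
nonnegative powers of its second variable. (The coefficient of `z₁^{-m-1} z₀^i` in
`∑_k z₂^{-k-1} (z₁ - z₀)^k` is `(-1)^i (i - m - 1 choose i) = (m choose i)` times a power of `z₂`.)
It is only used together with the truncation condition for `Y` and `YM`, which makes the three sums
finite. -/
def Jacobi (Y : ModeMap V V) (YM : ModeMap V M) : Prop :=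
  ∀ (u v : V) (w : M) (l m n : ℤ),
    (∑ᶠ i : ℕ, ((-1 : ℂ) ^ i * (Ring.choose l i : ℤ)) • YM u (l + m - i) (YM v (n + i) w))
      - (∑ᶠ i : ℕ, ((-1 : ℂ) ^ l * (-1 : ℂ) ^ i * (Ring.choose l i : ℤ)) •
          YM v (l + n - i) (YM u (m + i) w))
    = ∑ᶠ i : ℕ, ((Ring.choose m i : ℤ) : ℂ) • YM (Y u (l + i) v) (m + n - i) w

end ModeMap

/-- The structure of a vertex operator algebra on a complex vector space `V`. -/
structure VertexOperatorAlgebra (V : Type*) [AddCommGroup V] [Module ℂ V] where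
  /-- the state-field correspondence `Y(v, z) = ∑ v_n z^{-n-1}` -/
  Y : ModeMap V V
  /-- the vacuum vector `𝟏` -/
  vacuum : V
  /-- the conformal vector `ω` -/
  conformal : V
  /-- the central charge -/
  centralCharge : ℂ
  /-- the weight spaces `V_n` -/
  grading : ℤ → Submodule ℂ V
  isInternal_grading : DirectSum.IsInternal grading
  finiteDimensional_grading : ∀ n, FiniteDimensional ℂ (grading n)
  grading_bddBelow : ∃ N : ℤ, ∀ n < N, grading n = ⊥
  truncated : Y.Truncated
  /-- `Y(𝟏, z) = id` -/
  vacuum_mode : ∀ n : ℤ, Y vacuum n = if n = -1 then 1 else 0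
  /-- `Y(v, z)𝟏` has no negative powers of `z` -/
  creation_nonneg : ∀ (v : V) (n : ℤ), 0 ≤ n → Y v n vacuum = 0
  /-- the constant term of `Y(v, z)𝟏` is `v` -/
  creation : ∀ v : V, Y v (-1) vacuum = v
  jacobi : ModeMap.Jacobi Y Y
  /-- the Virasoro relations for `L(n) = ω_{n+1}` -/
  virasoro : ∀ m n : ℤ,
    Y conformal (m + 1) * Y conformal (n + 1) - Y conformal (n + 1) * Y conformal (m + 1)
      = ((m : ℂ) - n) • Y conformal (m + n + 1)
        + (if m + n = 0 then ((m : ℂ) ^ 3 - m) / 12 * centralCharge else 0) •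
          (1 : Module.End ℂ V)
  /-- `L(0) v = n v` for `v ∈ V_n` -/
  L_zero : ∀ (n : ℤ), ∀ v ∈ grading n, Y conformal 1 v = (n : ℂ) • v
  /-- `Y(L(-1)v, z) = d/dz Y(v, z)` -/
  L_neg_one : ∀ (v : V) (n : ℤ), Y (Y conformal 0 v) n = (-(n : ℂ)) • Y v (n - 1)

namespace VertexOperatorAlgebra

variable {V : Type*} [AddCommGroup V] [Module ℂ V]

/-- `V` is of CFT type: `V = ⨁_{n ≥ 0} V_n` and `V_0 = ℂ 𝟏`. -/
def IsCFTType (A : VertexOperatorAlgebra V) : Prop :=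
  (∀ n < 0, A.grading n = ⊥) ∧ A.grading 0 = Submodule.span ℂ {A.vacuum}

/-- `C_k(V)`, the linear span of the vectors `v_{-k} w` with `v, w ∈ V`. -/
def C (A : VertexOperatorAlgebra V) (k : ℕ) : Submodule ℂ V :=
  Submodule.span ℂ {x | ∃ v w : V, x = A.Y v (-(k : ℤ)) w}

/-- `V` is `C_k`-cofinite: `V / C_k(V)` is finite-dimensional. -/
def IsCCofinite (A : VertexOperatorAlgebra V) (k : ℕ) : Prop :=
  FiniteDimensional ℂ (V ⧸ A.C k)

/-- The structure of a weak module over the vertex operator algebra `A` on a complex vector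
space `M`. -/
structure WeakModule (A : VertexOperatorAlgebra V) (M : Type*) [AddCommGroup M] [Module ℂ M] where
  /-- the action `Y_M(v, z) = ∑ v_n z^{-n-1}` -/
  Y : ModeMap V M
  truncated : Y.Truncated
  /-- `Y_M(𝟏, z) = id` -/
  vacuum_mode : ∀ n : ℤ, Y A.vacuum n = if n = -1 then 1 else 0
  jacobi : ModeMap.Jacobi A.Y Y

namespace WeakModule

variable {M : Type*} [AddCommGroup M] [Module ℂ M] {A : VertexOperatorAlgebra V}

/-- A grading by the nonnegative integers, extended to all integers by `M(k) = 0` for `k < 0`. -/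
def extendGrading (G : ℕ → Submodule ℂ M) (k : ℤ) : Submodule ℂ M :=
  if 0 ≤ k then G k.toNat else ⊥

/-- A weak module is admissible if it carries a grading `M = ⨁_{n ≥ 0} M(n)` such that
`v_m M(n) ⊆ M(n + r - m - 1)` for all `v ∈ V_r`. -/
def IsAdmissible (W : A.WeakModule M) : Prop :=
  ∃ G : ℕ → Submodule ℂ M, DirectSum.IsInternal G ∧
    ∀ (r m : ℤ) (n : ℕ), ∀ v ∈ A.grading r, ∀ w ∈ G n,
      W.Y v m w ∈ extendGrading G (n + r - m - 1)

end WeakModule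

end VertexOperatorAlgebra

end

noncomputable section

/-! The grading comes from $L(0)$: it suffices that $L(0)$ is locally finite on $M$ and that the
real parts of its generalized eigenvalues are bounded below. A mode $v_m$ with $v\in V_r$ shifts
generalized eigenvalues by the integer $r-m-1$, so grouping the generalized eigenspaces by
$\lfloor\mathrm{Re}\,\mu\rfloor$ gives the required grading.

Local finiteness is a spanning argument. Filter words of modes applied to $w$ by the sum of the
weights of their vectors. Modulo smaller weight, modes commute and modes of $C_2(V)$ vanish, so only
vectors of weight in $[1,D]$ matter, and their modes of index at least some $L$ kill $w$. A repeated
index is removed by solving the formula for $(a_{-1}b)_{2n+1}$ for $a_nb_n$. Hence words with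
distinct indices below $L$ span (`word_mem_reducedSpan`). Their degrees are bounded below, and each
degree is finite-dimensional (`exists_stable_family`); $L(0)$ has degree $0$.

For the lower bound, every generalized eigenvalue is a nonnegative integer above one attained in
`lowest`, the space $\Omega$ of vectors killed by all modes of negative degree. The inclusion
$\Omega\to M$ is a single vector of a weak module of uniformly truncated families, with
componentwise action. Local finiteness of $L(0)$ at that vector yields one nonzero polynomial
killing all of $\Omega$ (`exists_aeval_L0_eq_zero_on_lowest`), so only finitely many eigenvalues
occur there. -/

theorem Int.ringChoose_neg_one (i : ℕ) : Ring.choose (-1 : ℤ) i = (-1) ^ i := by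
  have h : (1 : ℤ) + i - 1 = (i : ℕ) := by ring
  rw [Ring.choose_neg, h, Ring.choose_natCast, Nat.choose_self, Int.negOnePow_def,
    Nat.cast_one, Units.smul_def, zpow_natCast]
  simp

theorem Int.ringChoose_neg_two (i : ℕ) : Ring.choose (-2 : ℤ) i = (-1) ^ i * (i + 1) := by
  have h : (2 : ℤ) + i - 1 = (i + 1 : ℕ) := by push_cast; ring
  rw [Ring.choose_neg, h, Ring.choose_natCast, Nat.choose_succ_self_right, Int.negOnePow_def,
    Units.smul_def, zpow_natCast]
  simp

theorem finsum_mem_submodule {R M ι : Type*} [Semiring R] [AddCommMonoid M] [Module R M]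
    (S : Submodule R M) {f : ι → M} (h : ∀ i, f i ∈ S) : ∑ᶠ i, f i ∈ S :=
  finsum_induction (· ∈ S) S.zero_mem (fun _ _ => S.add_mem) h

/-- Finite support is essential: otherwise the `finsum` is $0$ by convention and says nothing about
its terms. -/
theorem mem_submodule_of_finsum_mem {R M ι : Type*} [Ring R] [AddCommGroup M] [Module R M]
    (S : Submodule R M) {f : ι → M} (hf : f.support.Finite) (hS : ∑ᶠ i, f i ∈ S) (i₀ : ι)
    (h : ∀ i, i ≠ i₀ → f i ∈ S) : f i₀ ∈ S := by
  classical
  rw [finsum_eq_sum_of_support_subset (s := insert i₀ hf.toFinset) f (by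
    intro x hx; simpa using Or.inr hx)] at hS
  rw [← Finset.add_sum_erase _ f (Finset.mem_insert_self _ _)] at hS
  refine (S.add_mem_iff_left (S.sum_mem fun i hi => h i (Finset.ne_of_mem_erase hi))).1 hS

/-! ### Mode calculus and weights. -/

namespace VertexOperatorAlgebra

variable {V : Type*} [AddCommGroup V] [Module ℂ V]

/-- A vertex operator algebra as a weak module over itself. -/
def adjoint (A : VertexOperatorAlgebra V) : A.WeakModule V where
  Y := A.Y
  truncated := A.truncated
  vacuum_mode := A.vacuum_mode
  jacobi := A.jacobi

namespace WeakModule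

variable {M : Type*} [AddCommGroup M] [Module ℂ M] {A : VertexOperatorAlgebra V}
  (W : A.WeakModule M)

theorem finite_support_mode (v : V) (w : M) (n : ℤ) :
    {i : ℕ | W.Y v (n + i) w ≠ 0}.Finite := by
  obtain ⟨N, hN⟩ := W.truncated v w
  refine (Set.finite_lt_nat (N - n).toNat).subset fun i hi => ?_
  by_contra h
  exact hi (hN _ (by simp only [Set.mem_ofPred_eq] at h; omega))

theorem commutator (u v : V) (w : M) (m n : ℤ) :
    W.Y u m (W.Y v n w) - W.Y v n (W.Y u m w)
      = ∑ᶠ i : ℕ, ((Ring.choose m i : ℤ) : ℂ) • W.Y (A.Y u i v) (m + n - i) w := by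
  have h := W.jacobi u v w 0 m n
  rw [finsum_eq_single _ 0 (fun i hi => by simp [Ring.choose_zero_pos ℤ (Nat.pos_of_ne_zero hi)]),
    finsum_eq_single _ 0 (fun i hi => by
      simp [Ring.choose_zero_pos ℤ (Nat.pos_of_ne_zero hi)])] at h
  simpa using h

theorem mode_mode (u v : V) (w : M) (l n : ℤ) :
    W.Y (A.Y u l v) n w
      = (∑ᶠ i : ℕ, ((-1 : ℂ) ^ i * (Ring.choose l i : ℤ)) • W.Y u (l - i) (W.Y v (n + i) w))
      - (∑ᶠ i : ℕ, ((-1 : ℂ) ^ l * (-1 : ℂ) ^ i * (Ring.choose l i : ℤ)) •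
          W.Y v (l + n - i) (W.Y u i w)) := by
  have h := W.jacobi u v w l 0 n
  symm
  rw [finsum_eq_single (fun i : ℕ => ((Ring.choose (0:ℤ) i : ℤ) : ℂ) •
    W.Y (A.Y u (l + i) v) (0 + n - i) w) 0 (fun i hi => by
      simp [Ring.choose_zero_pos ℤ (Nat.pos_of_ne_zero hi)])] at h
  simpa using h

theorem mode_neg_one_mode (u v : V) (w : M) (n : ℤ) :
    W.Y (A.Y u (-1) v) n w
      = (∑ᶠ i : ℕ, W.Y u (-1 - i) (W.Y v (n + i) w))
        + ∑ᶠ i : ℕ, W.Y v (-1 + n - i) (W.Y u i w) := by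
  rw [mode_mode, sub_eq_add_neg, ← finsum_neg_distrib]
  congr 1 <;> refine finsum_congr fun i => ?_
  · rw [Int.ringChoose_neg_one]
    push_cast
    rw [← mul_pow]
    simp
  · rw [Int.ringChoose_neg_one]
    push_cast
    rw [mul_assoc, ← mul_pow]
    simp

/-- Since $u_{-2}\mathbf 1=L(-1)u$, this is the $L(-1)$-derivative property, which for a weak module
has to be derived from the Jacobi identity. -/
theorem mode_translate (u : V) (n : ℤ) (w : M) :
    W.Y (A.Y u (-2) A.vacuum) n w = (-(n : ℂ)) • W.Y u (n - 1) w := by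
  have key : ∀ i : ℕ, (-1 : ℂ) ^ i * (Ring.choose (-2 : ℤ) i : ℤ) = i + 1 := by
    intro i
    rw [Int.ringChoose_neg_two]
    push_cast
    rw [← mul_assoc, ← mul_pow]
    simp
  rw [mode_mode]
  simp only [mul_assoc, key, W.vacuum_mode]
  -- Only the mode of $\mathbf 1$ of index $-1$ survives: it occurs in the first sum when $n<0$, in
  -- the second when $n>0$, and nowhere when $n=0$.
  rcases le_or_gt 0 n with hn | hn
  · rw [finsum_eq_zero_of_forall_eq_zero (fun i : ℕ => by
      rw [if_neg (by omega)]; simp)]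
    rcases hn.eq_or_lt with rfl | hn
    · rw [finsum_eq_zero_of_forall_eq_zero (fun i : ℕ => by
        rw [if_neg (by omega)]; simp)]
      simp
    · rw [finsum_eq_single _ (n - 1).toNat (fun i hi => by
        rw [if_neg (by omega)]; simp)]
      have h1 : (((n - 1).toNat : ℕ) : ℤ) = n - 1 := by omega
      have h2 : (((n - 1).toNat : ℕ) : ℂ) = n - 1 := by
        rw [← Int.cast_natCast, h1]; push_cast; ring
      rw [if_pos (by omega), h1, h2]
      simp
  · rw [finsum_eq_single _ (-1 - n).toNat (fun i hi => by
        rw [if_neg (by omega)]; simp),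
      finsum_eq_zero_of_forall_eq_zero (fun i : ℕ => by
        rw [if_neg (by omega)]; simp)]
    have h1 : (((-1 - n).toNat : ℕ) : ℤ) = -1 - n := by omega
    have h2 : (((-1 - n).toNat : ℕ) : ℂ) = -1 - n := by
      rw [← Int.cast_natCast, h1]; push_cast; ring
    rw [if_pos (by omega), h1, h2]
    simp only [Module.End.one_apply, sub_zero]
    congr 1
    · ring
    · rw [show (-2 : ℤ) - (-1 - n) = n - 1 by ring]

theorem conformal_zero_mode (u : V) :
    A.Y A.conformal 0 u = A.Y u (-2) A.vacuum := by
  have h := congrArg (fun f => f A.vacuum) (A.L_neg_one u (-1))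
  simpa [A.creation] using h

/-- The operator `L(0)`. -/
abbrev L0 : Module.End ℂ M := W.Y A.conformal 1

theorem L0_commutator {r : ℤ} {v : V} (hv : v ∈ A.grading r) (n : ℤ) (w : M) :
    W.L0 (W.Y v n w) = W.Y v n (W.L0 w) + ((r - n - 1 : ℤ) : ℂ) • W.Y v n w := by
  have h := W.commutator A.conformal v w 1 n
  rw [finsum_eq_sum_of_support_subset (s := Finset.range 2) _ (by
    intro i hi
    by_contra h'
    apply hi
    have h2 : 1 < i := by simpa using h'
    have : Ring.choose (1 : ℤ) i = 0 := by
      have := Ring.choose_natCast (R := ℤ) 1 i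
      simpa [Nat.choose_eq_zero_of_lt h2] using this
    simp [this])] at h
  rw [Finset.sum_range_succ, Finset.sum_range_one] at h
  simp only [Nat.cast_zero, Nat.cast_one, conformal_zero_mode, A.L_zero r v hv,
    mode_translate, Ring.choose_zero_right, Ring.choose_one_right, map_smul, Pi.smul_apply,
    LinearMap.smul_apply, Int.cast_one, one_smul] at h
  rw [sub_eq_iff_eq_add] at h
  rw [h]
  have e1 : (1 : ℤ) + n - 0 - 1 = n := by ring
  have e2 : (1 : ℤ) + n - 1 = n := by ring
  rw [e1, e2]
  push_cast
  module

end WeakModule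

variable (A : VertexOperatorAlgebra V)

/-- $L(0)$ acts on distinct weight spaces by distinct scalars, so membership in a weight space can
be tested by an eigenvalue equation. -/
theorem mem_grading_of_L_zero {k : ℤ} {v : V} (h : A.Y A.conformal 1 v = (k : ℂ) • v) :
    v ∈ A.grading k := by
  classical
  have hint := A.isInternal_grading
  let e := LinearEquiv.ofBijective (DirectSum.coeLinearMap A.grading) hint
  obtain ⟨x, rfl⟩ := e.surjective v
  have hL : ∀ y : DirectSum ℤ (fun i => A.grading i),
      A.Y A.conformal 1 (e y) = e (DFinsupp.mapRange.linearMap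
        (fun i : ℤ => (i : ℂ) • (LinearMap.id : A.grading i →ₗ[ℂ] A.grading i)) y) := by
    intro y
    induction y using DirectSum.induction_on with
    | zero => simp
    | of i z =>
      have h1 : e (DirectSum.of (fun i => A.grading i) i z) = z := DirectSum.coeLinearMap_of _ _ _
      rw [h1, A.L_zero i z z.2]
      have h2 : (DFinsupp.mapRange.linearMap
        (fun i => ((i : ℤ) : ℂ) • (LinearMap.id : A.grading i →ₗ[ℂ] A.grading i)))
          (DirectSum.of (fun i => A.grading i) i z)
          = DirectSum.of (fun i => A.grading i) i ((i : ℂ) • z) :=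
        DFinsupp.mapRange_single (hf := fun i => map_zero _)
      rw [h2]
      exact (DirectSum.coeLinearMap_of A.grading i ((i : ℂ) • z)).symm
    | add y z hy hz => simp only [map_add, hy, hz]
  rw [hL, ← map_smul] at h
  have h := e.injective h
  have hx : ∀ i, i ≠ k → x i = 0 := by
    intro i hi
    have h3 := congrArg (fun f : DirectSum ℤ (fun i => A.grading i) => f i) h
    have h4 : (i : ℂ) • x i = (k : ℂ) • x i := h3
    rw [← sub_eq_zero, ← sub_smul] at h4
    rcases smul_eq_zero.1 h4 with h5 | h5
    · exact absurd (by exact_mod_cast sub_eq_zero.1 h5) hi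
    · exact h5
  have hx' : x = DirectSum.of (fun i => A.grading i) k (x k) := by
    refine DFinsupp.ext fun i => ?_
    by_cases hi : i = k
    · subst hi; exact (DirectSum.of_eq_same (β := fun i => A.grading i) i (x i)).symm
    · rw [hx i hi]; exact (DirectSum.of_eq_of_ne (β := fun i => A.grading i) k i (x k) hi).symm
  rw [hx']
  have h1 : e (DirectSum.of (fun i => A.grading i) k (x k)) = x k :=
    DirectSum.coeLinearMap_of _ _ _
  rw [h1]
  exact (x k).2

theorem mode_mem_grading {r s : ℤ} {a b : V} (ha : a ∈ A.grading r) (hb : b ∈ A.grading s)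
    (n : ℤ) : A.Y a n b ∈ A.grading (r + s - n - 1) := by
  apply A.mem_grading_of_L_zero
  have h := A.adjoint.L0_commutator ha n b
  change A.Y A.conformal 1 (A.Y a n b) = A.Y a n (A.Y A.conformal 1 b) + _ • A.Y a n b at h
  rw [h, A.L_zero s b hb, map_smul]
  push_cast
  module

theorem conformal_mem_grading : A.conformal ∈ A.grading 2 := by
  apply A.mem_grading_of_L_zero
  have h := congrArg (fun f => f A.vacuum) (A.virasoro 0 (-2))
  have h0 : A.Y A.conformal 1 A.vacuum = 0 := A.creation_nonneg _ _ (by norm_num)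
  simpa [A.creation, h0] using h

end VertexOperatorAlgebra

/-! ### Homogeneous components of $C_2(V)$. -/

namespace VertexOperatorAlgebra

variable {V : Type*} [AddCommGroup V] [Module ℂ V] (A : VertexOperatorAlgebra V)

/-- The homogeneous component of weight `r`, as an endomorphism. -/
def component (r : ℤ) : Module.End ℂ V :=
  letI := A.isInternal_grading.chooseDecomposition
  (A.grading r).subtype ∘ₗ DirectSum.component ℂ ℤ (fun i => A.grading i) r ∘ₗ
    (DirectSum.decomposeLinearEquiv A.grading).toLinearMap

theorem component_of_mem {r : ℤ} {v : V} (hv : v ∈ A.grading r) : A.component r v = v := by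
  let := A.isInternal_grading.chooseDecomposition
  exact DirectSum.decompose_of_mem_same A.grading hv

theorem component_of_mem_ne {r s : ℤ} {v : V} (hv : v ∈ A.grading r) (h : r ≠ s) :
    A.component s v = 0 := by
  let := A.isInternal_grading.chooseDecomposition
  exact DirectSum.decompose_of_mem_ne A.grading hv h

theorem homogeneous_induction {p : V → Prop} (h0 : p 0)
    (hom : ∀ r, ∀ v ∈ A.grading r, p v) (add : ∀ v w, p v → p w → p (v + w)) (v : V) : p v := by
  let := A.isInternal_grading.chooseDecomposition
  exact DirectSum.Decomposition.inductionOn A.grading h0 (fun {i} m => hom i m m.2) add v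

theorem exists_component_eq_zero (v : V) : ∃ D : ℤ, ∀ r > D, A.component r v = 0 := by
  induction v using A.homogeneous_induction with
  | h0 => exact ⟨0, fun r _ => map_zero _⟩
  | hom s v hv => exact ⟨s, fun r hr => A.component_of_mem_ne hv hr.ne⟩
  | add v w hv hw =>
    obtain ⟨D, hD⟩ := hv
    obtain ⟨E, hE⟩ := hw
    refine ⟨max D E, fun r hr => ?_⟩
    rw [map_add, hD r (by omega), hE r (by omega), add_zero]

/-- The part of weight `r` of `C_2(V)`, spanned by the vectors `b_{-2} c` of weight `r` with `b`
and `c` homogeneous. -/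
def homogeneousC2 (r : ℤ) : Submodule ℂ V :=
  Submodule.span ℂ {x | ∃ s t : ℤ, ∃ b ∈ A.grading s, ∃ c ∈ A.grading t,
    s + t + 1 = r ∧ x = A.Y b (-2) c}

theorem component_mem_homogeneousC2 (r : ℤ) {x : V} (hx : x ∈ A.C 2) :
    A.component r x ∈ A.homogeneousC2 r := by
  induction hx using Submodule.span_induction with
  | zero => simp
  | add x y _ _ hx hy => rw [map_add]; exact add_mem hx hy
  | smul c x _ hx => rw [map_smul]; exact Submodule.smul_mem _ _ hx
  | mem x hx =>
    obtain ⟨v, w, rfl⟩ := hx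
    change A.component r (A.Y v (-2) w) ∈ _
    induction v using A.homogeneous_induction with
    | h0 => simp
    | add v v' hv hv' => simpa using add_mem hv hv'
    | hom s b hb =>
      induction w using A.homogeneous_induction with
      | h0 => simp
      | add w w' hw hw' => simpa using add_mem hw hw'
      | hom t c hc =>
        have h := A.mode_mem_grading hb hc (-2)
        by_cases hr : s + t + 1 = r
        · subst hr
          have h' : s + t - -2 - 1 = s + t + 1 := by ring
          rw [h'] at h
          rw [A.component_of_mem h]
          exact Submodule.subset_span ⟨s, t, b, hb, c, hc, rfl, rfl⟩
        · rw [A.component_of_mem_ne h (s := r) (by omega)]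
          exact zero_mem _

theorem exists_grading_le_homogeneousC2 (h : A.IsCCofinite 2) :
    ∃ D : ℤ, ∀ r > D, A.grading r ≤ A.homogeneousC2 r := by
  have hfin : FiniteDimensional ℂ (V ⧸ A.C 2) := h
  obtain ⟨S, hS⟩ := hfin.fg_top
  choose g hg using (A.C 2).mkQ_surjective
  choose d hd using A.exists_component_eq_zero
  -- Beyond this bound the chosen representatives of generators of $V/C_2(V)$ have no component, so
  -- every class has a representative with zero component in weight $r$.
  refine ⟨S.sum fun s => |d (g s)|, fun r hr x hx => ?_⟩
  have hmem : ∀ q : V ⧸ A.C 2, ∃ y, (A.C 2).mkQ y = q ∧ A.component r y = 0 := by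
    intro q
    have hq : q ∈ Submodule.span ℂ (S : Set (V ⧸ A.C 2)) := hS ▸ Submodule.mem_top
    induction hq using Submodule.span_induction with
    | zero => exact ⟨0, by simp, by simp⟩
    | add q q' _ _ hq hq' =>
      obtain ⟨y, hy, hy'⟩ := hq
      obtain ⟨z, hz, hz'⟩ := hq'
      exact ⟨y + z, by rw [map_add, hy, hz], by rw [map_add, hy', hz', add_zero]⟩
    | smul c q _ hq =>
      obtain ⟨y, hy, hy'⟩ := hq
      exact ⟨c • y, by rw [map_smul, hy], by rw [map_smul, hy', smul_zero]⟩
    | mem q hq =>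
      refine ⟨g q, hg q, hd _ _ (lt_of_le_of_lt ?_ hr)⟩
      exact (le_abs_self _).trans
        (Finset.single_le_sum (f := fun s => |d (g s)|) (fun _ _ => abs_nonneg _) hq)
  obtain ⟨y, hy, hy'⟩ := hmem ((A.C 2).mkQ x)
  have hxy : x - y ∈ A.C 2 := by
    rw [← Submodule.ker_mkQ (A.C 2), LinearMap.mem_ker, map_sub, hy, sub_self]
  have := A.component_mem_homogeneousC2 r hxy
  rwa [map_sub, hy', sub_zero, A.component_of_mem hx] at this

end VertexOperatorAlgebra

/-! ### Words of modes and the weight filtration. -/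

namespace VertexOperatorAlgebra

variable {V : Type*} [AddCommGroup V] [Module ℂ V]

/-- A mode `v_n` of a homogeneous vector `v`. -/
structure HomMode (A : VertexOperatorAlgebra V) where
  /-- the weight of the vector -/
  wt : ℤ
  /-- the index of the mode -/
  idx : ℤ
  /-- the vector -/
  vec : V
  mem : vec ∈ A.grading wt

namespace HomMode

variable {A : VertexOperatorAlgebra V}

/-- The degree of the operator `v_n`. -/
def deg (a : A.HomMode) : ℤ := a.wt - a.idx - 1

/-- The total weight of a word. -/
def weight (l : List A.HomMode) : ℤ := (l.map wt).sum

/-- The total degree of a word. -/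
def degree (l : List A.HomMode) : ℤ := (l.map deg).sum

@[simp] theorem weight_nil : weight ([] : List A.HomMode) = 0 := rfl
@[simp] theorem degree_nil : degree ([] : List A.HomMode) = 0 := rfl
@[simp] theorem weight_cons (a : A.HomMode) (l) : weight (a :: l) = a.wt + weight l := by
  simp [weight]
@[simp] theorem degree_cons (a : A.HomMode) (l) : degree (a :: l) = a.deg + degree l := by
  simp [degree]

theorem weight_perm {l l' : List A.HomMode} (h : l.Perm l') : weight l = weight l' :=
  (h.map _).sum_eq

theorem degree_perm {l l' : List A.HomMode} (h : l.Perm l') : degree l = degree l' :=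
  (h.map _).sum_eq

end HomMode

namespace WeakModule

open HomMode

variable {M : Type*} [AddCommGroup M] [Module ℂ M] {A : VertexOperatorAlgebra V}
  (W : A.WeakModule M) (w : M)

/-- The vector obtained by applying a word of modes to `w`. -/
def word (l : List A.HomMode) : M := l.foldr (fun a x => W.Y a.vec a.idx x) w

@[simp] theorem word_nil : W.word w [] = w := rfl
@[simp] theorem word_cons (a : A.HomMode) (l) :
    W.word w (a :: l) = W.Y a.vec a.idx (W.word w l) := rfl

/-- The span of the words of weight at most `p` and degree `d`. -/
def filt (p d : ℤ) : Submodule ℂ M :=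
  Submodule.span ℂ {x | ∃ l : List A.HomMode, weight l ≤ p ∧ degree l = d ∧ x = W.word w l}

variable {W w}

theorem word_mem_filt {p d : ℤ} {l : List A.HomMode} (hp : weight l ≤ p) (hd : degree l = d) :
    W.word w l ∈ W.filt w p d :=
  Submodule.subset_span ⟨l, hp, hd, rfl⟩

theorem mode_mem_filt {p q d e r n : ℤ} {a : V} {x : M} (ha : a ∈ A.grading r)
    (hx : x ∈ W.filt w p d) (hq : p + r ≤ q) (he : d + (r - n - 1) = e) :
    W.Y a n x ∈ W.filt w q e := by
  induction hx using Submodule.span_induction with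
  | zero => simp
  | add x y _ _ hx hy => rw [map_add]; exact add_mem hx hy
  | smul c x _ hx => rw [map_smul]; exact Submodule.smul_mem _ _ hx
  | mem x hx =>
    obtain ⟨l, hl, hl', rfl⟩ := hx
    exact word_mem_filt (l := ⟨r, n, a, ha⟩ :: l) (by simp; omega) (by simp [deg]; omega)

/-- The commutator involves only modes of $a_ib$ with $i\ge 0$, of weight $r+s-i-1\le r+s-1$. -/
theorem commutator_mem_filt {p q d e r s m n : ℤ} {a b : V} {x : M} (ha : a ∈ A.grading r)
    (hb : b ∈ A.grading s) (hx : x ∈ W.filt w p d) (hq : p + r + s - 1 ≤ q)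
    (he : d + (r - m - 1) + (s - n - 1) = e) :
    W.Y a m (W.Y b n x) - W.Y b n (W.Y a m x) ∈ W.filt w q e := by
  rw [commutator]
  exact finsum_mem_submodule _ fun i => Submodule.smul_mem _ _
    (mode_mem_filt (A.mode_mem_grading ha hb i) hx (by omega) (by omega))

/-- A mode of $b_{-2}c$ expands into products of one mode of $b$ and one of $c$, whose weights add
up to one less than that of $b_{-2}c$. -/
theorem homogeneousC2_mode_mem_filt {p q d e r n : ℤ} {a : V} {x : M}
    (ha : a ∈ A.homogeneousC2 r) (hx : x ∈ W.filt w p d) (hq : p + r - 1 ≤ q)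
    (he : d + (r - n - 1) = e) : W.Y a n x ∈ W.filt w q e := by
  induction ha using Submodule.span_induction with
  | zero => simp
  | add a b _ _ ha hb => simpa using add_mem ha hb
  | smul c a _ ha => simpa using Submodule.smul_mem _ c ha
  | mem a ha =>
    obtain ⟨s, t, b, hb, c, hc, hr, rfl⟩ := ha
    rw [mode_mode]
    refine sub_mem ?_ ?_ <;> refine finsum_mem_submodule _ fun i => Submodule.smul_mem _ _ ?_
    · exact mode_mem_filt hb (mode_mem_filt hc hx le_rfl rfl) (by omega) (by omega)
    · exact mode_mem_filt hc (mode_mem_filt hb hx le_rfl rfl) (by omega) (by omega)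

theorem word_sub_word_mem_filt {l l' : List A.HomMode} (h : l.Perm l') :
    W.word w l - W.word w l' ∈ W.filt w (weight l - 1) (degree l) := by
  induction h with
  | nil => simp
  | cons a h ih =>
    rw [word_cons, word_cons, ← map_sub]
    exact mode_mem_filt a.mem ih (by simp; omega) (by simp [deg]; omega)
  | swap a b l =>
    exact commutator_mem_filt b.mem a.mem (word_mem_filt (l := l) le_rfl rfl) (by simp; omega)
      (by simp [deg]; omega)
  | trans h h' ih ih' =>
    rw [← weight_perm h, ← degree_perm h] at ih'
    simpa using add_mem ih ih'

theorem word_append_mode_eq_zero (l : List A.HomMode) {a : A.HomMode}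
    (h : W.Y a.vec a.idx w = 0) : W.word w (l ++ [a]) = 0 := by
  induction l with
  | nil => simpa using h
  | cons b l ih => simp [ih]

end WeakModule

end VertexOperatorAlgebra

/-! ### Reduced words span. -/

theorem List.exists_perm_cons_cons_of_not_nodup_map {α β : Type*} (f : α → β) {l : List α}
    (h : ¬ (l.map f).Nodup) : ∃ a b l', l.Perm (a :: b :: l') ∧ f a = f b := by
  induction l with
  | nil => simp at h
  | cons c l ih =>
    rw [List.map_cons, List.nodup_cons, not_and_or, not_not] at h
    rcases h with h | h
    · obtain ⟨b, hb, hbc⟩ := List.mem_map.1 h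
      obtain ⟨s, t, rfl⟩ := List.append_of_mem hb
      exact ⟨c, b, s ++ t, List.perm_middle.cons _, hbc.symm⟩
    · obtain ⟨a, b, l', hl, hab⟩ := ih h
      exact ⟨a, b, c :: l', (hl.cons c).trans
        ((List.Perm.swap a c _).trans ((List.Perm.swap b c _).cons a)), hab⟩

theorem List.sum_map_sq_le_sq_sum {α : Type*} (f : α → ℤ) (l : List α) (h : ∀ a ∈ l, 0 ≤ f a) :
    0 ≤ (l.map f).sum ∧ (l.map fun a => f a ^ 2).sum ≤ (l.map f).sum ^ 2 := by
  induction l with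
  | nil => simp
  | cons a l ih =>
    have ha := h a (by simp)
    obtain ⟨h1, h2⟩ := ih fun b hb => h b (by simp [hb])
    simp only [List.map_cons, List.sum_cons]
    exact ⟨by omega, by nlinarith [mul_nonneg ha h1]⟩

namespace VertexOperatorAlgebra

variable {V : Type*} [AddCommGroup V] [Module ℂ V]

namespace WeakModule

open HomMode

variable {M : Type*} [AddCommGroup M] [Module ℂ M] {A : VertexOperatorAlgebra V}
  (W : A.WeakModule M) (w : M)

/-- A word is reduced if its weights lie in `[1, D]` and its mode indices are distinct and less
than `L`. -/
def Reduced (D L : ℤ) (l : List A.HomMode) : Prop :=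
  (∀ a ∈ l, 1 ≤ a.wt ∧ a.wt ≤ D ∧ a.idx < L) ∧ (l.map idx).Nodup

/-- The span of the reduced words of degree `d`. -/
def reducedSpan (D L d : ℤ) : Submodule ℂ M :=
  Submodule.span ℂ {x | ∃ l : List A.HomMode, Reduced D L l ∧ degree l = d ∧ x = W.word w l}

variable {W w} {D L : ℤ}

theorem word_eq_zero_of_weight_neg (hCFT : A.IsCFTType) {l : List A.HomMode}
    (h : weight l < 0) : W.word w l = 0 := by
  induction l with
  | nil => simp at h
  | cons a l ih =>
    rcases lt_or_ge a.wt 0 with ha | ha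
    · have h0 : a.vec = 0 := by simpa [hCFT.1 _ ha] using a.mem
      simp [h0]
    · rw [weight_cons] at h
      simp [ih (by omega)]

/-- Solving the associativity formula for `(a_{-1} b)_{2n+1}` for the term `a_n b_n`. -/
theorem mode_mode_mem_of_mode_neg_one_mode_mem (S : Submodule ℂ M) {a b : V} {x : M} {n : ℤ}
    (hab : W.Y (A.Y a (-1) b) (2 * n + 1) x ∈ S)
    (hcomm : ∀ i j : ℤ, i + j = 2 * n → W.Y a i (W.Y b j x) - W.Y b j (W.Y a i x) ∈ S)
    (hne : ∀ i j : ℤ, i + j = 2 * n → i ≠ j → W.Y a i (W.Y b j x) ∈ S) :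
    W.Y a n (W.Y b n x) ∈ S := by
  have hne' : ∀ i j : ℤ, i + j = 2 * n → i ≠ j → W.Y b j (W.Y a i x) ∈ S := fun i j h h' => by
    simpa using sub_mem (hne i j h h') (hcomm i j h)
  rw [mode_neg_one_mode] at hab
  -- The diagonal term is $a_nb_n$ in the first sum if $n<0$, and $b_na_n$ in the second if $n\ge
  -- 0$.
  rcases lt_or_ge n 0 with hn | hn
  · rw [S.add_mem_iff_left (finsum_mem_submodule _ fun i => hne' _ _ (by ring) (by omega))] at hab
    have := mem_submodule_of_finsum_mem S
      ((W.finite_support_mode b x (2 * n + 1)).subset fun i hi h0 => hi (by simp [h0]))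
      hab (-1 - n).toNat fun i hi => hne _ _ (by ring) (by omega)
    have e : (((-1 - n).toNat : ℕ) : ℤ) = -1 - n := by omega
    rw [e] at this
    ring_nf at this
    exact this
  · rw [S.add_mem_iff_right (finsum_mem_submodule _ fun i => hne _ _ (by ring) (by omega))] at hab
    have := mem_submodule_of_finsum_mem S
      ((W.finite_support_mode a x 0).subset fun i hi h0 => hi (by simp_all))
      hab n.toNat fun i hi => hne' _ _ (by ring) (by omega)
    have e : ((n.toNat : ℕ) : ℤ) = n := by omega
    rw [e, show -1 + (2 * n + 1) - n = n by ring] at this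
    simpa using add_mem (hcomm n n (by ring)) this

theorem word_mem_reducedSpan (hCFT : A.IsCFTType) (hD : ∀ r > D, A.grading r ≤ A.homogeneousC2 r)
    (hL : ∀ r, 1 ≤ r → r ≤ D → ∀ a ∈ A.grading r, ∀ n ≥ L, W.Y a n w = 0)
    (l : List A.HomMode) : W.word w l ∈ W.reducedSpan w D L (degree l) := by
  -- Nested inductions: on weight, then length, then $(\sum x)^2-\sum x^2$ with $x=L-\mathrm{idx}$.
  -- The last quantity is twice the sum of products of pairs and drops when two equal indices are
  -- spread apart.
  suffices H : ∀ P : ℕ, ∀ l : List A.HomMode, weight l < P →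
      W.word w l ∈ W.reducedSpan w D L (degree l) from H ((weight l).toNat + 1) l (by omega)
  intro P
  induction P with
  | zero =>
    intro l hl
    rw [word_eq_zero_of_weight_neg hCFT (by simpa using hl)]
    exact zero_mem _
  | succ P ihP =>
    have low : ∀ (q d : ℤ), q < P → W.filt w q d ≤ W.reducedSpan w D L d := by
      intro q d hq
      refine Submodule.span_le.2 ?_
      rintro x ⟨l, hl, rfl, rfl⟩
      exact ihP l (by omega)
    have of_perm : ∀ l l' : List A.HomMode, weight l < P + 1 → l.Perm l' →
        W.word w l' ∈ W.reducedSpan w D L (degree l') →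
        W.word w l ∈ W.reducedSpan w D L (degree l) := by
      intro l l' hl h h'
      rw [← degree_perm h] at h'
      simpa using add_mem (low _ _ (by omega) (word_sub_word_mem_filt h)) h'
    suffices H : ∀ K : ℕ, ∀ l : List A.HomMode, weight l < P + 1 → l.length < K →
        W.word w l ∈ W.reducedSpan w D L (degree l) from
      fun l hl => H (l.length + 1) l (by exact_mod_cast hl) (by omega)
    intro K
    induction K with
    | zero => intro l _ h; omega
    | succ K ihK =>
      suffices H : ∀ T : ℕ, ∀ l : List A.HomMode, weight l < P + 1 → l.length < K + 1 →
          (l.map fun a : A.HomMode => L - a.idx).sum ^ 2 -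
            (l.map fun a : A.HomMode => (L - a.idx) ^ 2).sum < T →
          W.word w l ∈ W.reducedSpan w D L (degree l) from
        fun l hl hK => H (((l.map fun a : A.HomMode => L - a.idx).sum ^ 2 -
          (l.map fun a : A.HomMode => (L - a.idx) ^ 2).sum).toNat + 1) l hl hK (by omega)
      intro T
      induction T with
      | zero | succ T ihT => ?_
      all_goals
        intro l hl hK hT
        by_cases hwt : ∀ a ∈ l, 1 ≤ a.wt ∧ a.wt ≤ D
        swap
        · push Not at hwt
          obtain ⟨a, ha, hwt⟩ := hwt
          obtain ⟨s, t, rfl⟩ := List.append_of_mem ha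
          refine of_perm _ _ hl List.perm_middle ?_
          rw [weight_perm List.perm_middle, weight_cons] at hl
          rw [word_cons, degree_cons]
          rcases lt_trichotomy a.wt 0 with h0 | h0 | h0
          · have : a.vec = 0 := by simpa [hCFT.1 _ h0] using a.mem
            simp [this]
          · have hm := a.mem
            rw [h0, hCFT.2] at hm
            obtain ⟨c, hc⟩ := Submodule.mem_span_singleton.1 hm
            rw [← hc, map_smul, Pi.smul_apply, W.vacuum_mode]
            split_ifs with hi
            · have := ihK (s ++ t) (by omega) (by simp at hK ⊢; omega)
              rw [show a.deg = 0 by simp [deg, h0, hi], zero_add]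
              simpa using Submodule.smul_mem _ c this
            · simp
          · refine low _ _ ?_ (homogeneousC2_mode_mem_filt (hD _ (hwt (by omega)) a.mem)
              (word_mem_filt (l := s ++ t) le_rfl rfl) le_rfl (by rw [deg]; ring))
            omega
        by_cases hidx : ∀ a ∈ l, a.idx < L
        swap
        · push Not at hidx
          obtain ⟨a, ha, hidx⟩ := hidx
          obtain ⟨s, t, rfl⟩ := List.append_of_mem ha
          refine of_perm _ ((s ++ t) ++ [a]) hl
            (List.perm_middle.trans (List.perm_append_singleton _ _).symm) ?_
          rw [word_append_mode_eq_zero _ (hL _ (hwt a ha).1 (hwt a ha).2 _ a.mem _ hidx)]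
          exact zero_mem _
        by_cases hnd : (l.map idx).Nodup
        · exact Submodule.subset_span
            ⟨l, ⟨fun a ha => ⟨(hwt a ha).1, (hwt a ha).2, hidx a ha⟩, hnd⟩, rfl, rfl⟩
        have hsq := List.sum_map_sq_le_sq_sum (fun a : A.HomMode => L - a.idx) l
          fun a ha => by have := hidx a ha; omega
      -- The measure is nonnegative only once all indices are below $L$, so the earlier reductions
      -- are needed in the base case too.
      · simp only [Nat.cast_zero] at hT
        omega
      · obtain ⟨a, b, l', hp, hab⟩ := List.exists_perm_cons_cons_of_not_nodup_map _ hnd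
        refine of_perm _ _ hl hp ?_
        rw [weight_perm hp, weight_cons, weight_cons] at hl
        rw [hp.length_eq] at hK
        rw [(hp.map _).sum_eq, (hp.map _).sum_eq] at hT
        simp only [List.length_cons] at hK
        simp only [List.map_cons, List.sum_cons, ← hab] at hT
        simp only [word_cons, ← hab]
        have hdeg : degree (a :: b :: l') = degree l' + a.wt + b.wt - 2 * a.idx - 2 := by
          simp [deg, ← hab]; ring
        rw [hdeg]
        apply mode_mode_mem_of_mode_neg_one_mode_mem
        -- Replacing two modes by one of $a_{-1}b$ keeps the total weight and shortens the word.
        · have h := A.mode_mem_grading a.mem b.mem (-1)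
          have := ihK (⟨_, 2 * a.idx + 1, _, h⟩ :: l') (by simp; omega) (by simp; omega)
          rw [word_cons, degree_cons] at this
          convert this using 2
          simp [deg]; ring
        · intro i j hij
          exact low (weight (a :: b :: l') - 1) _ (by simp; omega)
            (commutator_mem_filt a.mem b.mem (word_mem_filt (l := l') le_rfl rfl)
              (by simp; omega) (by omega))
        · intro i j hij hne
          have := ihT (⟨_, i, _, a.mem⟩ :: ⟨_, j, _, b.mem⟩ :: l') (by simp; omega)
            (by simp; omega) (by
              simp only [List.map_cons, List.sum_cons]
              have h1 : j = 2 * a.idx - i := by omega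
              subst h1
              -- Passing from indices $(n,n)$ to $(i,2n-i)$ keeps the sum and raises the sum of
              -- squares by $2(i-n)^2$.
              have h2 : 0 < (i - a.idx) ^ 2 := by
                have : i - a.idx ≠ 0 := by omega
                positivity
              push_cast at hT
              nlinarith)
          rw [word_cons, word_cons, degree_cons, degree_cons] at this
          convert this using 2
          simp [deg]; omega

end WeakModule

end VertexOperatorAlgebra

/-! ### Degree bounds and finite-dimensionality. -/

theorem List.Nodup.length_mul_le_two_mul_sum {l : List ℤ} (h : l.Nodup) (h0 : ∀ x ∈ l, 0 ≤ x) :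
    (l.length : ℤ) * (l.length - 1) ≤ 2 * l.sum := by
  have h1 := Finset.sum_range_le_sum (s := l.toFinset) (c := 0) (by simpa using h0)
  rw [List.toFinset_card_of_nodup h, List.sum_toFinset (fun x => x) h, List.map_id'] at h1
  have h2 : ∀ k : ℕ, 2 * ∑ n ∈ Finset.range k, (0 + (n : ℤ)) = k * (k - 1) := by
    intro k
    induction k with
    | zero => simp
    | succ k ih => rw [Finset.sum_range_succ, mul_add, ih]; push_cast; ring
  linarith [h2 l.length]

namespace VertexOperatorAlgebra

variable {V : Type*} [AddCommGroup V] [Module ℂ V]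

namespace WeakModule

open HomMode

variable {M : Type*} [AddCommGroup M] [Module ℂ M] {A : VertexOperatorAlgebra V}
  {W : A.WeakModule M} {w : M} {D L : ℤ}

theorem sum_le_degree {l : List A.HomMode} (h : ∀ a ∈ l, 1 ≤ a.wt) :
    (l.map fun a : A.HomMode => L - 1 - a.idx).sum ≤ degree l + l.length * (L - 1) := by
  induction l with
  | nil => simp
  | cons a l ih =>
    have h1 := h a (by simp)
    have h2 := ih fun b hb => h b (by simp [hb])
    simp only [List.map_cons, List.sum_cons, degree_cons, List.length_cons, deg]
    push_cast
    linarith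

/-- The numbers $L-1-\mathrm{idx}$ are distinct and nonnegative, so their sum grows quadratically in
the length, while weights at least $1$ make the degree at least that sum minus a linear term. -/
theorem Reduced.length_mul_le {l : List A.HomMode} (h : Reduced D L l) :
    (l.length : ℤ) * (l.length + 1 - 2 * L) ≤ 2 * degree l := by
  have h1 := sum_le_degree (L := L) fun a ha => (h.1 a ha).1
  have h2 : (l.map fun a : A.HomMode => L - 1 - a.idx).Nodup := by
    have := h.2.map (f := fun n : ℤ => L - 1 - n) (fun x y hxy => by simpa using hxy)
    simpa [List.map_map, Function.comp_def] using this
  have h3 := h2.length_mul_le_two_mul_sum (by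
    intro x hx
    obtain ⟨a, ha, rfl⟩ := List.mem_map.1 hx
    have := (h.1 a ha).2.2
    omega)
  rw [List.length_map] at h3
  linarith

theorem Reduced.neg_sq_le_degree {l : List A.HomMode} (h : Reduced D L l) :
    -L ^ 2 ≤ degree l := by
  have h1 := h.length_mul_le
  have h2 : (0 : ℤ) ≤ l.length := by positivity
  nlinarith [sq_nonneg ((l.length : ℤ) - L)]

theorem Reduced.length_le {l : List A.HomMode} (h : Reduced D L l) :
    (l.length : ℤ) ≤ 2 * |L| + 2 * |degree l| := by
  have h1 := h.length_mul_le
  have h2 := le_abs_self L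
  have h3 := le_abs_self (degree l)
  have h4 := abs_nonneg L
  have h5 := abs_nonneg (degree l)
  by_contra! h6
  nlinarith [mul_pos (show (0 : ℤ) < l.length by linarith)
    (show (0 : ℤ) < l.length - (2 * |L| + 2 * |degree l|) by linarith)]

theorem Reduced.le_idx {l : List A.HomMode} (h : Reduced D L l) {a : A.HomMode} (ha : a ∈ l) :
    L - 1 - (degree l + (2 * |L| + 2 * |degree l|) * |L|) ≤ a.idx := by
  have h1 := sum_le_degree (L := L) fun a ha => (h.1 a ha).1
  have h2 : L - 1 - a.idx ≤ (l.map fun a : A.HomMode => L - 1 - a.idx).sum := by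
    refine List.single_le_sum ?_ _ (List.mem_map.2 ⟨a, ha, rfl⟩)
    intro x hx
    obtain ⟨a, ha, rfl⟩ := List.mem_map.1 hx
    have := (h.1 a ha).2.2
    omega
  have h3 := mul_le_mul_of_nonneg_right h.length_le (abs_nonneg L)
  have h4 := mul_le_mul_of_nonneg_left (show L - 1 ≤ |L| by linarith [le_abs_self L])
    (show (0 : ℤ) ≤ l.length by positivity)
  linarith

variable (W) in
/-- The action of the modes with index `n`, as a bilinear map. -/
def modeLinear (n : ℤ) : V →ₗ[ℂ] M →ₗ[ℂ] M := LinearMap.proj n ∘ₗ W.Y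

variable (W w) in
/-- The span of the vectors obtained from `w` by applying at most `k` modes with index in `s`
of vectors in `U`. -/
def boundedSpan (U : Submodule ℂ V) (s : Finset ℤ) : ℕ → Submodule ℂ M
  | 0 => Submodule.span ℂ {w}
  | k + 1 => boundedSpan U s k ⊔ s.sup fun n => Submodule.map₂ (W.modeLinear n) U
      (boundedSpan U s k)

theorem boundedSpan_fg {U : Submodule ℂ V} (hU : U.FG) (s : Finset ℤ) (k : ℕ) :
    (W.boundedSpan w U s k).FG := by
  induction k with
  | zero => exact Submodule.fg_span_singleton w
  | succ k ih =>
    exact ih.sup (Submodule.fg_finset_sup s _ fun n _ => hU.map₂ _ ih)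

theorem word_mem_boundedSpan {U : Submodule ℂ V} {s : Finset ℤ} {l : List A.HomMode}
    (h : ∀ a ∈ l, a.vec ∈ U ∧ a.idx ∈ s) {k : ℕ} (hk : l.length ≤ k) :
    W.word w l ∈ W.boundedSpan w U s k := by
  induction k generalizing l with
  | zero =>
    obtain rfl : l = [] := List.length_eq_zero_iff.1 (by omega)
    exact Submodule.mem_span_singleton_self w
  | succ k ih =>
    cases l with
    | nil => exact Submodule.mem_sup_left (ih (by simp) (by simp))
    | cons a l =>
      refine Submodule.mem_sup_right ?_
      have h1 := ih (l := l) (fun b hb => h b (by simp [hb])) (by simpa using hk)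
      exact Finset.le_sup (f := fun n => Submodule.map₂ (W.modeLinear n) U _) (h a (by simp)).2
        (Submodule.apply_mem_map₂ (W.modeLinear a.idx) (h a (by simp)).1 h1)

theorem exists_forall_mode_eq_zero {U : Submodule ℂ V} (hU : U.FG) (W : A.WeakModule M) (w : M) :
    ∃ L : ℤ, ∀ a ∈ U, ∀ n ≥ L, W.Y a n w = 0 := by
  obtain ⟨S, rfl⟩ := hU
  choose N hN using fun v => W.truncated v w
  refine ⟨S.sum fun v => |N v|, fun a ha n hn => ?_⟩
  induction ha using Submodule.span_induction with
  | zero => simp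
  | add a b _ _ ha hb => simp [ha, hb]
  | smul c a _ ha => simp [ha]
  | mem a ha =>
    refine hN a n (le_trans ?_ hn)
    exact (le_abs_self _).trans
      (Finset.single_le_sum (f := fun v => |N v|) (fun _ _ => abs_nonneg _) ha)

/-- A family of subspaces is stable if the homogeneous modes shift it by their degree. -/
def IsStable (W : A.WeakModule M) (N : ℤ → Submodule ℂ M) : Prop :=
  ∀ (r n d : ℤ), ∀ a ∈ A.grading r, ∀ x ∈ N d, W.Y a n x ∈ N (d + (r - n - 1))

/-- Stability under modes is evident for the span of all words, finiteness for that of reduced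
words. -/
theorem reducedSpan_eq (hCFT : A.IsCFTType) (hD : ∀ r > D, A.grading r ≤ A.homogeneousC2 r)
    (hL : ∀ r, 1 ≤ r → r ≤ D → ∀ a ∈ A.grading r, ∀ n ≥ L, W.Y a n w = 0) (d : ℤ) :
    W.reducedSpan w D L d
      = Submodule.span ℂ {x | ∃ l : List A.HomMode, degree l = d ∧ x = W.word w l} := by
  apply le_antisymm
  · refine Submodule.span_mono ?_
    rintro x ⟨l, -, hl, rfl⟩
    exact ⟨l, hl, rfl⟩
  · refine Submodule.span_le.2 ?_
    rintro x ⟨l, rfl, rfl⟩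
    exact word_mem_reducedSpan hCFT hD hL l

/-- The submodule generated by a vector is, for a `C_2`-cofinite vertex operator algebra of
CFT type, spanned by finite-dimensional subspaces whose degrees are bounded below. -/
theorem exists_stable_family (hCFT : A.IsCFTType) (hC2 : A.IsCCofinite 2) (W : A.WeakModule M)
    (w : M) : ∃ N : ℤ → Submodule ℂ M, w ∈ N 0 ∧ W.IsStable N ∧ (∀ d, (N d).FG) ∧
      (∃ d₀, ∀ d < d₀, N d = ⊥) ∧
      ∀ G : ℤ → Submodule ℂ M, w ∈ G 0 → W.IsStable G → ∀ d, N d ≤ G d := by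
  obtain ⟨D, hD⟩ := A.exists_grading_le_homogeneousC2 hC2
  let U : Submodule ℂ V := (Finset.Icc 1 D).sup A.grading
  have hU : U.FG := Submodule.fg_finset_sup _ _ fun r _ =>
    (Submodule.fg_iff_finiteDimensional _).2 (A.finiteDimensional_grading r)
  have hrU : ∀ r, 1 ≤ r → r ≤ D → A.grading r ≤ U := fun r h1 h2 =>
    Finset.le_sup (f := A.grading) (Finset.mem_Icc.2 ⟨h1, h2⟩)
  obtain ⟨L, hL⟩ := exists_forall_mode_eq_zero hU W w
  have hspan := reducedSpan_eq hCFT hD (fun r h1 h2 a ha => hL a (hrU r h1 h2 ha))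
  refine ⟨W.reducedSpan w D L, ?_, ?_, fun d => ?_, ⟨-L ^ 2, fun d hd => ?_⟩, ?_⟩
  · exact Submodule.subset_span ⟨[], ⟨by simp, by simp⟩, rfl, rfl⟩
  · intro r n d a ha x hx
    rw [hspan] at hx ⊢
    induction hx using Submodule.span_induction with
    | zero => simp
    | add x y _ _ hx hy => rw [map_add]; exact add_mem hx hy
    | smul c x _ hx => rw [map_smul]; exact Submodule.smul_mem _ _ hx
    | mem x hx =>
      obtain ⟨l, rfl, rfl⟩ := hx
      exact Submodule.subset_span ⟨⟨r, n, a, ha⟩ :: l, by simp [deg]; ring, rfl⟩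
  -- In fixed degree the length is bounded and the indices lie in a finite window.
  · have hle : W.reducedSpan w D L d ≤ W.boundedSpan w U
        (Finset.Icc (L - 1 - (d + (2 * |L| + 2 * |d|) * |L|)) L) (2 * |L| + 2 * |d|).toNat := by
      refine Submodule.span_le.2 ?_
      rintro x ⟨l, hl, rfl, rfl⟩
      refine word_mem_boundedSpan (fun a ha => ⟨hrU _ (hl.1 a ha).1 (hl.1 a ha).2.1 a.mem,
        Finset.mem_Icc.2 ⟨hl.le_idx ha, (hl.1 a ha).2.2.le⟩⟩) ?_
      have := hl.length_le
      omega
    have := (Submodule.fg_iff_finiteDimensional _).1 (boundedSpan_fg (W := W) (w := w) hU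
      (Finset.Icc (L - 1 - (d + (2 * |L| + 2 * |d|) * |L|)) L) (2 * |L| + 2 * |d|).toNat)
    exact (Submodule.fg_iff_finiteDimensional _).2 (Submodule.finiteDimensional_of_le hle)
  · rw [eq_bot_iff]
    refine Submodule.span_le.2 ?_
    rintro x ⟨l, hl, rfl, rfl⟩
    exact absurd hl.neg_sq_le_degree (by omega)
  · intro G hG0 hG d
    refine Submodule.span_le.2 ?_
    rintro x ⟨l, -, rfl, rfl⟩
    induction l with
    | nil => exact hG0
    | cons a l ih =>
      have := hG a.wt a.idx _ a.vec a.mem _ ih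
      rw [degree_cons, add_comm]
      exact this

end WeakModule

end VertexOperatorAlgebra

/-! ### Uniformly truncated families and lowest vectors. -/

namespace VertexOperatorAlgebra

variable {V : Type*} [AddCommGroup V] [Module ℂ V]

namespace WeakModule

variable {M : Type*} [AddCommGroup M] [Module ℂ M] {A : VertexOperatorAlgebra V}
  (W : A.WeakModule M) (ι : Type*)

/-- The families of vectors of a weak module that satisfy the truncation condition uniformly. -/
def truncatedFamilies : Submodule ℂ (ι → M) where
  carrier := {f | ∀ v : V, ∃ N : ℤ, ∀ n : ℤ, N ≤ n → ∀ i, W.Y v n (f i) = 0}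
  zero_mem' := fun v => ⟨0, fun n _ i => by simp⟩
  add_mem' := by
    intro f g hf hg v
    obtain ⟨N, hN⟩ := hf v
    obtain ⟨N', hN'⟩ := hg v
    refine ⟨max N N', fun n hn i => ?_⟩
    rw [Pi.add_apply, map_add, hN n (by omega), hN' n (by omega), add_zero]
  smul_mem' := by
    intro c f hf v
    obtain ⟨N, hN⟩ := hf v
    exact ⟨N, fun n hn i => by rw [Pi.smul_apply, map_smul, hN n hn, smul_zero]⟩

variable {W ι} in
theorem mode_mem_truncatedFamilies {f : ι → M} (hf : f ∈ W.truncatedFamilies ι) (u : V) (m : ℤ) :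
    (fun i => W.Y u m (f i)) ∈ W.truncatedFamilies ι := by
  intro v
  obtain ⟨N, hN⟩ := hf v
  obtain ⟨J, hJ⟩ := A.truncated v u
  choose K hK using fun j : ℕ => hf (A.Y v j u)
  let B : ℤ := ∑ j ∈ Finset.range J.toNat, |K j|
  -- By the commutator formula only $(v_ju)_{n+m-j}$ with $0\le j<J$ remain, and this bound puts
  -- each of these indices above $K_j$.
  refine ⟨max N (B + J.toNat - m), fun n hn i => ?_⟩
  have h := W.commutator v u (f i) n m
  rw [hN n (by omega), map_zero, sub_zero] at h
  rw [h]
  refine finsum_eq_zero_of_forall_eq_zero fun j => ?_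
  rcases lt_or_ge j J.toNat with hj | hj
  · have h1 : |K j| ≤ B := Finset.single_le_sum (f := fun j => |K j|)
      (fun _ _ => abs_nonneg _) (Finset.mem_range.2 hj)
    have h2 := le_abs_self (K j)
    rw [hK j _ (by omega), smul_zero]
  · rw [hJ j (by omega)]
    simp

/-- The componentwise action on the families of vectors that satisfy the truncation condition
uniformly. -/
def truncatedFamiliesMode : ModeMap V (W.truncatedFamilies ι) where
  toFun v n :=
    { toFun := fun f => ⟨fun i => W.Y v n (f.1 i), mode_mem_truncatedFamilies f.2 v n⟩
      map_add' := fun f g => by ext i; simp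
      map_smul' := fun c f => by ext i; simp }
  map_add' u v := by ext n f i; simp
  map_smul' c u := by ext n f i; simp

variable {W ι} in
theorem truncatedFamiliesMode_apply (v : V) (n : ℤ) (f : W.truncatedFamilies ι) (i : ι) :
    (W.truncatedFamiliesMode ι v n f).1 i = W.Y v n (f.1 i) := rfl

variable {W ι} in
theorem truncatedFamiliesMode_eq_zero {v : V} {n : ℤ} {f : W.truncatedFamilies ι}
    (h : ∀ i, W.Y v n (f.1 i) = 0) : W.truncatedFamiliesMode ι v n f = 0 :=
  Subtype.ext (funext h)

theorem truncatedFamiliesMode_jacobi : ModeMap.Jacobi A.Y (W.truncatedFamiliesMode ι) := by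
  intro u v f l m n
  obtain ⟨Nu, hNu⟩ := f.2 u
  obtain ⟨Nv, hNv⟩ := f.2 v
  obtain ⟨J, hJ⟩ := A.truncated u v
  have fin : ∀ N k : ℤ, {i : ℕ | k + i < N}.Finite := fun N k =>
    (Set.finite_lt_nat (N - k).toNat).subset fun i hi => by
      simp only [Set.mem_ofPred_eq] at hi ⊢; omega
  apply Subtype.ext
  funext i
  let ev : W.truncatedFamilies ι →ₗ[ℂ] M :=
    LinearMap.proj i ∘ₗ (W.truncatedFamilies ι).subtype
  have hev : ∀ v n f, ev (W.truncatedFamiliesMode ι v n f) = W.Y v n (ev f) := fun _ _ _ => rfl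
  suffices h : ∀ x y, ev x = ev y → x.1 i = y.1 i by
    apply h
    rw [map_sub]
    -- Evaluation commutes with the three sums because their supports are finite uniformly in the
    -- component.
    erw [ev.toAddMonoidHom.map_finsum, ev.toAddMonoidHom.map_finsum, ev.toAddMonoidHom.map_finsum]
    · simpa only [LinearMap.toAddMonoidHom_coe, map_smul, hev] using W.jacobi u v (ev f) l m n
    · refine (fin J l).subset fun j hj => ?_
      by_contra h
      refine hj ?_
      simp only
      rw [hJ _ (by simpa using h)]
      simp
    · refine (fin Nu m).subset fun j hj => ?_
      by_contra h
      refine hj ?_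
      simp only
      rw [truncatedFamiliesMode_eq_zero (v := u) (fun i => hNu _ (by simpa using h) i)]
      simp
    · refine (fin Nv n).subset fun j hj => ?_
      by_contra h
      refine hj ?_
      simp only
      rw [truncatedFamiliesMode_eq_zero (v := v) (fun i => hNv _ (by simpa using h) i)]
      simp
  exact fun x y h => h

/-- The weak module of the families of vectors that satisfy the truncation condition uniformly. -/
def truncatedFamiliesModule : A.WeakModule (W.truncatedFamilies ι) where
  Y := W.truncatedFamiliesMode ι
  truncated := fun v f => by
    obtain ⟨N, hN⟩ := f.2 v
    exact ⟨N, fun n hn => truncatedFamiliesMode_eq_zero (hN n hn)⟩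
  vacuum_mode := fun n => by
    ext f i
    rw [truncatedFamiliesMode_apply, W.vacuum_mode]
    split_ifs <;> simp
  jacobi := W.truncatedFamiliesMode_jacobi ι

/-- The set of vectors killed by all homogeneous modes of negative degree. -/
def lowest : Set M := {y | ∀ r n : ℤ, ∀ a ∈ A.grading r, r ≤ n → W.Y a n y = 0}

/-- For $v\in V_r$ the truncation bound $r$ serves every lowest vector. -/
theorem coe_lowest_mem_truncatedFamilies :
    (fun y : W.lowest => (y : M)) ∈ W.truncatedFamilies W.lowest := by
  intro v
  induction v using A.homogeneous_induction with
  | h0 => exact ⟨0, by simp⟩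
  | hom r v hv => exact ⟨r, fun n hn y => y.2 r n v hv hn⟩
  | add u v hu hv =>
    obtain ⟨N, hN⟩ := hu
    obtain ⟨N', hN'⟩ := hv
    refine ⟨max N N', fun n hn y => ?_⟩
    rw [map_add, Pi.add_apply, LinearMap.add_apply, hN n (by omega), hN' n (by omega), add_zero]

theorem L0_stable {N : ℤ → Submodule ℂ M} (h : W.IsStable N) {d : ℤ} {x : M} (hx : x ∈ N d) :
    W.L0 x ∈ N d := by
  simpa using h 2 1 d _ A.conformal_mem_grading x hx

/-- The operator `L(0)` is locally finite. -/
theorem exists_fg_L0_stable (hCFT : A.IsCFTType) (hC2 : A.IsCCofinite 2) (w : M) :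
    ∃ N : Submodule ℂ M, w ∈ N ∧ N.FG ∧ ∀ x ∈ N, W.L0 x ∈ N := by
  obtain ⟨N, hw, hN, hfg, -⟩ := exists_stable_family hCFT hC2 W w
  exact ⟨N 0, hw, hfg 0, fun x hx => W.L0_stable hN hx⟩

theorem exists_aeval_L0_eq_zero (hCFT : A.IsCFTType) (hC2 : A.IsCCofinite 2) (w : M) :
    ∃ p : Polynomial ℂ, p ≠ 0 ∧ Polynomial.aeval W.L0 p w = 0 := by
  obtain ⟨N, hw, hfg, hN⟩ := W.exists_fg_L0_stable hCFT hC2 w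
  have := (Submodule.fg_iff_finiteDimensional _).1 hfg
  refine ⟨minpoly ℂ (W.L0.restrict hN), minpoly.ne_zero (Algebra.IsIntegral.isIntegral _), ?_⟩
  have h1 : ∀ (p : Polynomial ℂ) (x : N),
      ((Polynomial.aeval (W.L0.restrict hN) p x : N) : M) = Polynomial.aeval W.L0 p (x : M) := by
    intro p
    induction p using Polynomial.induction_on' with
    | add p q hp hq => intro x; simp [hp, hq]
    | monomial n c =>
      intro x
      rw [Polynomial.aeval_monomial, Polynomial.aeval_monomial, Module.End.pow_restrict n]
      simp [Algebra.algebraMap_eq_smul_one]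
  rw [← h1 _ ⟨w, hw⟩, minpoly.aeval]
  rfl

theorem exists_aeval_L0_eq_zero_on_lowest (hCFT : A.IsCFTType) (hC2 : A.IsCCofinite 2) :
    ∃ p : Polynomial ℂ, p ≠ 0 ∧ ∀ y ∈ W.lowest, Polynomial.aeval W.L0 p y = 0 := by
  obtain ⟨p, hp, h⟩ := (W.truncatedFamiliesModule W.lowest).exists_aeval_L0_eq_zero hCFT hC2
    ⟨_, W.coe_lowest_mem_truncatedFamilies⟩
  refine ⟨p, hp, fun y hy => ?_⟩
  have h1 : ∀ (q : Polynomial ℂ) (f : W.truncatedFamilies W.lowest) (i : W.lowest),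
      (Polynomial.aeval (W.truncatedFamiliesModule W.lowest).L0 q f).1 i
        = Polynomial.aeval W.L0 q (f.1 i) := by
    intro q
    induction q using Polynomial.induction_on' with
    | add q r hq hr => intro f i; simp [hq, hr]
    | monomial n c =>
      intro f i
      rw [Polynomial.aeval_monomial, Polynomial.aeval_monomial]
      have h2 : ∀ (n : ℕ) (f : W.truncatedFamilies W.lowest),
          (((W.truncatedFamiliesModule W.lowest).L0 ^ n) f).1 i = (W.L0 ^ n) (f.1 i) := by
        intro n
        induction n with
        | zero => intro f; simp
        | succ n ih => intro f; rw [pow_succ, pow_succ, Module.End.mul_apply, ih]; rfl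
      simp [Algebra.algebraMap_eq_smul_one, h2]
  have := congrFun (congrArg Subtype.val h) ⟨y, hy⟩
  rw [h1] at this
  exact this

end WeakModule

end VertexOperatorAlgebra

/-! ### Generalized eigenvalues of $L(0)$. -/

theorem iSupIndep.iSup_fiber {ι κ α : Type*} [CompleteLattice α] [IsModularLattice α]
    [IsCompactlyGenerated α] {t : ι → α} (ht : iSupIndep t) (h : ι → κ) :
    iSupIndep fun k => ⨆ i, ⨆ (_ : h i = k), t i := by
  intro k
  have hd : Disjoint {i | h i = k} {i | h i ≠ k} := Set.disjoint_left.2 fun i hi hi' => hi' hi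
  refine (ht.disjoint_biSup_biSup hd).mono_right ?_
  refine iSup_le fun j => iSup_le fun hj => iSup_le fun i => iSup_le fun hi => ?_
  subst hi
  exact le_biSup t hj

/-- An endomorphism of a complex vector space which is locally finite is locally triangularizable. -/
theorem Module.End.iSup_maxGenEigenspace_eq_top_of_locallyFinite {M : Type*} [AddCommGroup M]
    [Module ℂ M] (f : Module.End ℂ M)
    (h : ∀ w, ∃ N : Submodule ℂ M, w ∈ N ∧ N.FG ∧ ∀ x ∈ N, f x ∈ N) :
    ⨆ μ, f.maxGenEigenspace μ = ⊤ := by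
  rw [eq_top_iff]
  intro w _
  obtain ⟨N, hw, hfg, hN⟩ := h w
  have := (Submodule.fg_iff_finiteDimensional _).1 hfg
  let g : Module.End ℂ N := f.restrict hN
  have hmem : (⟨w, hw⟩ : N) ∈ ⨆ μ, g.maxGenEigenspace μ :=
    g.iSup_maxGenEigenspace_eq_top ▸ Submodule.mem_top
  have hle : ⨆ μ, g.maxGenEigenspace μ ≤ (⨆ μ, f.maxGenEigenspace μ).comap N.subtype := by
    refine iSup_le fun μ => ?_
    have : g.maxGenEigenspace μ = (f.maxGenEigenspace μ).comap N.subtype :=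
      f.genEigenspace_restrict N ⊤ μ hN
    rw [this]
    exact Submodule.comap_mono (le_iSup _ μ)
  exact hle hmem

namespace VertexOperatorAlgebra

variable {V : Type*} [AddCommGroup V] [Module ℂ V]

namespace WeakModule

variable {M : Type*} [AddCommGroup M] [Module ℂ M] {A : VertexOperatorAlgebra V}
  (W : A.WeakModule M)

theorem mode_mem_maxGenEigenspace {r n : ℤ} {a : V} (ha : a ∈ A.grading r) {μ : ℂ} {x : M}
    (hx : x ∈ W.L0.maxGenEigenspace μ) :
    W.Y a n x ∈ W.L0.maxGenEigenspace (μ + ((r - n - 1 : ℤ) : ℂ)) := by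
  rw [Module.End.mem_maxGenEigenspace] at hx ⊢
  obtain ⟨k, hk⟩ := hx
  refine ⟨k, ?_⟩
  have h : ∀ (k : ℕ) (x : M), ((W.L0 - (μ + ((r - n - 1 : ℤ) : ℂ)) • 1) ^ k) (W.Y a n x)
      = W.Y a n (((W.L0 - μ • 1) ^ k) x) := by
    intro k
    induction k with
    | zero => intro x; simp
    | succ k ih =>
      intro x
      rw [pow_succ, pow_succ, Module.End.mul_apply, Module.End.mul_apply, ← ih]
      congr 1
      simp only [LinearMap.sub_apply, LinearMap.smul_apply, Module.End.one_apply, map_sub,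
        map_smul, W.L0_commutator ha]
      module
  rw [h, hk, map_zero]

theorem isStable_maxGenEigenspace (μ : ℂ) :
    W.IsStable fun d => W.L0.maxGenEigenspace (μ + (d : ℂ)) := by
  intro r n d a ha x hx
  have := W.mode_mem_maxGenEigenspace ha (n := n) hx
  simp only
  rwa [Int.cast_add, ← add_assoc]

/-- If $\mu$ were not a root, $p$ would be coprime to $(X-\mu)^k$, and a vector killed by both is
zero. -/
theorem isRoot_of_mem_lowest {p : Polynomial ℂ} {μ : ℂ} {y : M} (hy : y ≠ 0)
    (hμ : y ∈ W.L0.maxGenEigenspace μ) (hp : Polynomial.aeval W.L0 p y = 0) : p.IsRoot μ := by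
  by_contra hroot
  rw [Module.End.mem_maxGenEigenspace] at hμ
  obtain ⟨k, hk⟩ := hμ
  have hco : IsCoprime p ((Polynomial.X - Polynomial.C μ) ^ k) := by
    refine IsCoprime.pow_right ((Polynomial.irreducible_X_sub_C μ).coprime_iff_not_dvd.2 ?_).symm
    rwa [Polynomial.dvd_iff_isRoot]
  obtain ⟨u, v, huv⟩ := hco
  have h := congrArg (fun q => Polynomial.aeval W.L0 q y) huv
  have hk' : Polynomial.aeval W.L0 ((Polynomial.X - Polynomial.C μ) ^ k) y = 0 := by
    simpa [Algebra.algebraMap_eq_smul_one] using hk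
  simp only [map_add, map_mul, LinearMap.add_apply, Module.End.mul_apply, hp, hk', map_zero,
    map_one, Module.End.one_apply, add_zero] at h
  exact hy h.symm

theorem exists_lowest_of_mem_maxGenEigenspace (hCFT : A.IsCFTType) (hC2 : A.IsCCofinite 2)
    {μ : ℂ} {x : M} (hx : x ∈ W.L0.maxGenEigenspace μ) (hx0 : x ≠ 0) :
    ∃ d ≤ (0 : ℤ), ∃ y ∈ W.lowest, y ≠ 0 ∧ y ∈ W.L0.maxGenEigenspace (μ + (d : ℂ)) := by
  obtain ⟨N, hxN, hN, -, ⟨d₀, hd₀⟩, hmin⟩ := exists_stable_family hCFT hC2 W x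
  -- A nonzero vector in the least nonzero degree is killed by modes of negative degree; minimality
  -- of the family puts it in the eigenspace for $\mu+d$.
  obtain ⟨d, hd, hleast⟩ := Int.exists_least_of_bdd (P := fun d => N d ≠ ⊥)
    ⟨d₀, fun d hd => by by_contra h; exact hd (hd₀ d (by omega))⟩
    ⟨0, fun h => hx0 (by simpa [h] using hxN)⟩
  obtain ⟨y, hyN, hy0⟩ := (N d).ne_bot_iff.1 hd
  refine ⟨d, hleast 0 fun h => hx0 (by simpa [h] using hxN), y, ?_, hy0,
    hmin _ (by simpa using hx) (W.isStable_maxGenEigenspace μ) d hyN⟩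
  intro r n a ha hrn
  have h := hN r n d a ha y hyN
  by_contra h0
  have := hleast _ ((N _).ne_bot_iff.2 ⟨_, h, h0⟩)
  omega

/-- The real parts of the generalized eigenvalues of `L(0)` are bounded below. -/
theorem exists_le_floor_re (hCFT : A.IsCFTType) (hC2 : A.IsCCofinite 2) :
    ∃ B : ℤ, ∀ μ : ℂ, W.L0.maxGenEigenspace μ ≠ ⊥ → B ≤ ⌊μ.re⌋ := by
  obtain ⟨p, hp0, hp⟩ := W.exists_aeval_L0_eq_zero_on_lowest hCFT hC2
  obtain ⟨B, hB⟩ := (p.roots.toFinset.image fun μ : ℂ => ⌊μ.re⌋).bddBelow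
  refine ⟨B, fun μ hμ => ?_⟩
  obtain ⟨x, hx, hx0⟩ := (Submodule.ne_bot_iff _).1 hμ
  obtain ⟨d, hd, y, hy, hy0, hyμ⟩ := W.exists_lowest_of_mem_maxGenEigenspace hCFT hC2 hx hx0
  have hroot := W.isRoot_of_mem_lowest hy0 hyμ (hp y hy)
  have h := hB (Finset.mem_coe.2 (Finset.mem_image_of_mem (fun μ : ℂ => ⌊μ.re⌋)
    (Multiset.mem_toFinset.2 ((Polynomial.mem_roots hp0).2 hroot))))
  simp only [Complex.add_re, Complex.intCast_re, Int.floor_add_intCast] at h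
  omega

end WeakModule

end VertexOperatorAlgebra

end

/-! ### The grading. -/

theorem proposition5p6 {V : Type*} [AddCommGroup V] [Module ℂ V]
    (A : VertexOperatorAlgebra V) (hCFT : A.IsCFTType) (hC2 : A.IsCCofinite 2)
    {M : Type*} [AddCommGroup M] [Module ℂ M] (W : A.WeakModule M) :
    W.IsAdmissible := by
  obtain ⟨B, hB⟩ := W.exists_le_floor_re hCFT hC2
  let G : ℤ → Submodule ℂ M := fun k =>
    ⨆ μ : ℂ, ⨆ (_ : ⌊μ.re⌋ - B = k), W.L0.maxGenEigenspace μ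
  have hneg : ∀ k < 0, G k = ⊥ := by
    intro k hk
    refine iSup_eq_bot.2 fun μ => iSup_eq_bot.2 fun hμ => ?_
    by_contra h
    have := hB μ h
    omega
  have hind : iSupIndep G :=
    W.L0.independent_maxGenEigenspace.iSup_fiber fun μ : ℂ => ⌊μ.re⌋ - B
  refine ⟨fun n => G n, DirectSum.isInternal_submodule_of_iSupIndep_of_iSup_eq_top
    (hind.comp Nat.cast_injective) ?_, ?_⟩
  · rw [eq_top_iff, ← W.L0.iSup_maxGenEigenspace_eq_top_of_locallyFinite
      fun w => W.exists_fg_L0_stable hCFT hC2 w]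
    refine iSup_le fun μ => ?_
    by_cases hμ : W.L0.maxGenEigenspace μ = ⊥
    · rw [hμ]; exact bot_le
    have h := hB μ hμ
    -- The truncation to naturals is harmless, since $B$ bounds $\lfloor\mathrm{Re}\,\mu\rfloor$
    -- below when the eigenspace is nonzero.
    refine le_iSup_of_le (⌊μ.re⌋ - B).toNat ?_
    exact le_iSup₂_of_le (f := fun (μ : ℂ) (_ : ⌊μ.re⌋ - B = _) => W.L0.maxGenEigenspace μ) μ
      (by omega) le_rfl
  · intro r m n v hv w hw
    have hmem : W.Y v m w ∈ G (n + r - m - 1) := by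
      have hle : G n ≤ (G (n + r - m - 1)).comap (W.Y v m) := by
        refine iSup_le fun μ => iSup_le fun hμ => fun x hx => ?_
        refine (le_iSup₂_of_le (f := fun (μ : ℂ) (_ : ⌊μ.re⌋ - B = n + r - m - 1) =>
          W.L0.maxGenEigenspace μ) (μ + ((r - m - 1 : ℤ) : ℂ)) ?_ le_rfl)
          (W.mode_mem_maxGenEigenspace hv hx)
        rw [Complex.add_re, Complex.intCast_re, Int.floor_add_intCast]
        omega
      exact hle hw
    rw [VertexOperatorAlgebra.WeakModule.extendGrading]
    split_ifs with hk
    · rwa [Int.toNat_of_nonneg hk]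
    · rwa [hneg _ (by omega)] at hmem
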